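/- Let $V$ be a rational vector space with a symmetric bilinear form $B\colon V\times V\to\mathbb Q$, and put $Q(v)=\tfrac12B(v,v)$. A lattice $L\subset V$ is a finitely generated subgroup that spans $V$ over $\mathbb Q$ (so $V$ is finite-dimensional as soon as it contains a lattice). It is called integral if $B(x,y)\in\mathbb Z$ for all $x,y\in L$. Put $L^\#=\{v\in V\mid B(v,\ell)\in\mathbb Z\ \text{for all}\ \ell\in L\}$. A function $\psi\colon T\to\mathbb Q/\mathbb Z$ on a finite abelian group is quadratic if $\psi(ax)=a^2\psi(x)$ for all $a\in\mathbb Z$, $x\in T$, and $(x,y)\mapsto\psi(x+y)-\psi(x)-\psi(y)$ is bilinear. It is said to enhance this bilinear form, and is non-singular if $0$ is the only $x\in T$ with $\psi(x+y)=\psi(x)+\psi(y)$ for all $y\in T$. Its Gauss sum is $G(\psi)=\sum_{t\in T}e^{2\pi i\psi(t)}$; when $G(\psi)\ne0$, its phase $\beta(\psi)\in\mathbb R/\mathbb Z$ is defined by $G(\psi)=|G(\psi)|\,e^{2\pi i\beta(\psi)}$. Then: 1. If $L$ is an integral lattice, then $L\subset L^\#$. 2. If $L$ is a lattice and $Q(x)\in\mathbb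 Z$ for all $x\in L$, then $L$ is integral. 3. If $B$ is non-singular and $L$ is an integral lattice, then $L^\#/L$ is finite. 4. If $B$ is non-singular and $L$ is a lattice with $Q(x)\in\mathbb Z$ for all $x\in L$, then $B$ induces a symmetric bilinear form $b_L\colon L^\#/L\times L^\#/L\to\mathbb Q/\mathbb Z$, and $Q$ induces a non-singular quadratic function $\psi_L\colon L^\#/L\to\mathbb Q/\mathbb Z$ that enhances $b_L$. Moreover $G(\psi_L)\ne0$ and $$\beta(\psi_L)=\frac{\sigma(B)}{8}\in\mathbb Q/\mathbb Z\subset\mathbb R/\mathbb Z,$$ where $\sigma(B)$ denotes the signature of $B$. -/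

import Mathlib

namespace Milgram

noncomputable section

/-- The inclusion `ℚ/ℤ → ℝ/ℤ` induced by `ℚ ⊂ ℝ`. -/
def ratToReal : AddCircle (1 : ℚ) →+ AddCircle (1 : ℝ) :=
  QuotientAddGroup.map (AddSubgroup.zmultiples (1 : ℚ)) (AddSubgroup.zmultiples (1 : ℝ))
    (Rat.castHom ℝ).toAddMonoidHom (by
      rintro _ ⟨n, rfl⟩
      exact ⟨n, by simp⟩)

theorem ratToReal_coe (q : ℚ) :
    ratToReal (q : AddCircle (1 : ℚ)) = ((q : ℝ) : AddCircle (1 : ℝ)) := rfl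

/-- The Gauss sum `G(ψ) = ∑_{t ∈ T} exp(2πi ψ(t))` of a function `ψ : T → ℝ/ℤ`
on a finite set `T`. -/
def gaussSum {T : Type*} (ψ : T → AddCircle (1 : ℝ)) : ℂ :=
  ∑ᶠ t, ((ψ t).toCircle : ℂ)

/-- The phase `β(ψ) ∈ ℝ/ℤ` of a Gauss sum, meaningful when `G(ψ) ≠ 0`; it is then the unique
`β ∈ ℝ/ℤ` with `G(ψ) = |G(ψ)| · exp(2πi β)`, see `gaussSum_eq_iff`. -/
def phase {T : Type*} (ψ : T → AddCircle (1 : ℝ)) : AddCircle (1 : ℝ) :=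
  (((gaussSum ψ).arg / (2 * Real.pi) : ℝ) : AddCircle (1 : ℝ))

theorem gaussSum_eq {T : Type*} (ψ : T → AddCircle (1 : ℝ)) :
    gaussSum ψ = (‖gaussSum ψ‖ : ℂ) * ((phase ψ).toCircle : ℂ) := by
  have h : 2 * Real.pi / 1 * ((gaussSum ψ).arg / (2 * Real.pi)) = (gaussSum ψ).arg := by
    field_simp [Real.pi_ne_zero]
  rw [phase, AddCircle.toCircle_apply_mk, h, Circle.coe_exp, Complex.norm_mul_exp_arg_mul_I]

/-- The phase is characterized by its defining equation. -/
theorem gaussSum_eq_iff {T : Type*} (ψ : T → AddCircle (1 : ℝ)) (hψ : gaussSum ψ ≠ 0)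
    (β : AddCircle (1 : ℝ)) :
    gaussSum ψ = (‖gaussSum ψ‖ : ℂ) * (β.toCircle : ℂ) ↔ β = phase ψ := by
  constructor
  · intro h
    have h' := h.symm.trans (gaussSum_eq ψ)
    have hn : (‖gaussSum ψ‖ : ℂ) ≠ 0 := by simpa using hψ
    exact AddCircle.injective_toCircle one_ne_zero (Circle.ext (mul_left_cancel₀ hn h'))
  · rintro rfl
    exact gaussSum_eq ψ

/-- A quadratic function `ψ : T → ℚ/ℤ` is non-singular if its associated bilinear form
`(x, y) ↦ ψ(x + y) - ψ(x) - ψ(y)` satisfies `T^⊥ = 0`. -/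
def IsNonsingular {T : Type*} [AddCommGroup T] (ψ : QuadraticMap ℤ T (AddCircle (1 : ℚ))) : Prop :=
  ∀ x : T, (∀ y : T, QuadraticMap.polar ψ x y = 0) → x = 0

variable {V : Type*} [AddCommGroup V] [Module ℚ V]

/-- The signature `σ(B)`: the dimension of a maximal positive definite subspace minus that of a
maximal negative definite one. -/
def signature (B : LinearMap.BilinForm ℚ V) : ℤ :=
  (sigPos (LinearMap.BilinMap.toQuadraticMap B) : ℤ)
    - (sigNeg (LinearMap.BilinMap.toQuadraticMap B) : ℤ)

/-- `L` is integral if `B` takes integer values on `L × L`. -/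
def IsIntegral (B : LinearMap.BilinForm ℚ V) (L : Submodule ℤ V) : Prop :=
  ∀ x ∈ L, ∀ y ∈ L, ∃ n : ℤ, B x y = n

/-- `Q(v) = B(v, v) / 2` takes integer values on `L`. -/
def IsEven (B : LinearMap.BilinForm ℚ V) (L : Submodule ℤ V) : Prop :=
  ∀ x ∈ L, ∃ n : ℤ, B x x / 2 = n

/-- The dual lattice `L^# = {v ∈ V | B(v, ℓ) ∈ ℤ for all ℓ ∈ L}`. -/
abbrev dual (B : LinearMap.BilinForm ℚ V) (L : Submodule ℤ V) : Submodule ℤ V :=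
  B.dualSubmodule L

theorem mem_dual {B : LinearMap.BilinForm ℚ V} {L : Submodule ℤ V} {v : V} :
    v ∈ dual B L ↔ ∀ l ∈ L, ∃ n : ℤ, B v l = n := by
  simp [LinearMap.BilinForm.mem_dualSubmodule, Submodule.mem_one, eq_comm]

/-- The discriminant group `L^# / L` (of interest when `L ⊆ L^#`; in general this is
`L^# / (L ∩ L^#)`). -/
abbrev Discr (B : LinearMap.BilinForm ℚ V) (L : Submodule ℤ V) : Type _ :=
  dual B L ⧸ L.submoduleOf (dual B L)

/-- The class in `L^# / L` of an element of `L^#`. -/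
abbrev Discr.mk (B : LinearMap.BilinForm ℚ V) (L : Submodule ℤ V) (x : dual B L) : Discr B L :=
  Submodule.Quotient.mk x

end

end Milgram

/-! The phase of the Gauss sum is insensitive to passing to a sublattice. If `L' ≤ L` are even
lattices and `B` is non-degenerate, then `L/L'` is a subgroup of `L'^#/L'` on which `ψ_{L'}`
vanishes, and its orthogonal complement is `L^#/L'`. Averaging over `L/L'` kills the terms off the
complement and leaves `|L/L'|` copies of `G(ψ_L)` (`sum_discrQuad_sublattice`).

Over `ℚ` the form is diagonalized by a basis that can be scaled into `L` (`exists_isEvenDiagonal`).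
For the span of such a basis, with `B(vᵢ, vᵢ) = 2aᵢ`, the discriminant group is `∏ ℤ/2aᵢ` and the
Gauss sum is a product of one-dimensional ones, each equal to `√(2|aᵢ|) exp(2πi sign(aᵢ)/8)`. The
signs add up to `σ(B)` (`IsEvenDiagonal.sum_discrQuad`).

The one-dimensional sum `sum_exp_pi_mul_sq_div` is the analytic input: it is read off from the
behaviour of Jacobi's theta function near the cusp `1/m`. The algebraic claims rest on polarization,
on `L^#/L` being finitely generated torsion, and on `L^## = L`. -/

namespace Milgram

/-! ### The one-dimensional quadratic Gauss sum via theta functions. -/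

section QuadraticGaussSum

open Complex HurwitzZeta Filter Topology

/-- Write `n = km + r`. As `m` is even, `k²m + 2kr` is even, so `exp(πi n²/m)` depends on `r` only
and factors out of the Gaussian sum over `k`. -/
theorem jacobiTheta_eq_sum_evenKernel (m : ℕ) [NeZero m] (hm : Even m) {ε : ℝ} (hε : 0 < ε) :
    jacobiTheta (1 / m + I * ε) = ∑ r : Fin m,
      cexp (Real.pi * I * ((r : ℕ) : ℂ) ^ 2 / m) *
        (evenKernel (((r : ℕ) / m : ℝ) : UnitAddCircle) (m ^ 2 * ε) : ℂ) := by
  have hm0 : (m : ℂ) ≠ 0 := Nat.cast_ne_zero.mpr (NeZero.ne m)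
  have hm0' : (m : ℝ) ≠ 0 := Nat.cast_ne_zero.mpr (NeZero.ne m)
  have hmpos : (0 : ℝ) < m := Nat.cast_pos.mpr (NeZero.pos m)
  have him : 0 < (1 / (m : ℂ) + I * ε).im := by
    have : (1 / (m : ℂ)) = ((1 / m : ℝ) : ℂ) := by push_cast; rfl
    rw [this]
    simpa using hε
  have h1 := hasSum_jacobiTheta₂_term 0 him
  rw [← jacobiTheta_eq_jacobiTheta₂] at h1
  have h2 := ((Equiv.prodComm _ _).trans (Int.divModEquiv m).symm).hasSum_iff.mpr h1
  refine HasSum.unique (HasSum.prod_fiberwise h2 fun r => ?_) (hasSum_fintype _)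
  have h3 := (hasSum_int_evenKernel ((r : ℕ) / m : ℝ)
    (show (0 : ℝ) < m ^ 2 * ε by positivity)).mapL ofRealCLM
  refine (h3.mul_left (cexp (Real.pi * I * ((r : ℕ) : ℂ) ^ 2 / m))).congr_fun fun k => ?_
  obtain ⟨s, hs⟩ := hm
  have key : Real.pi * I * ((k * m + (r : ℕ) : ℤ) : ℂ) ^ 2 * (1 / m + I * ε)
      = Real.pi * I * ((r : ℕ) : ℂ) ^ 2 / m +
        (-Real.pi * (k + (r : ℕ) / m) ^ 2 * (m ^ 2 * ε) : ℝ) +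
        ((s * k ^ 2 + k * (r : ℕ) : ℤ) : ℂ) * (2 * Real.pi * I) := by
    have hs' : (m : ℂ) = s + s := by exact_mod_cast hs
    push_cast
    field_simp
    ring_nf
    simp only [I_sq]
    rw [hs']
    ring
  simp only [Function.comp, jacobiTheta₂_term, Equiv.trans_apply, Equiv.prodComm_apply,
    Prod.swap, Int.divModEquiv, Equiv.coe_fn_symm_mk, ofRealCLM_apply]
  rw [mul_zero, zero_add, key, exp_add, exp_int_mul_two_pi_mul_I, mul_one, exp_add, ofReal_exp]

theorem jacobiTheta_functional_equation (τ : ℂ) :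
    jacobiTheta τ = 1 / (-I * τ) ^ (1 / 2 : ℂ) * jacobiTheta (-1 / τ) := by
  have := jacobiTheta₂_functional_equation 0 τ
  simpa [jacobiTheta_eq_jacobiTheta₂] using this

theorem jacobiTheta_sub_even_natCast (τ : ℂ) {m : ℕ} (hm : Even m) :
    jacobiTheta (τ - m) = jacobiTheta τ := by
  obtain ⟨s, rfl⟩ := hm
  induction s with
  | zero => simp
  | succ s ih =>
    rw [← ih, ← jacobiTheta_two_add]
    congr 1
    push_cast
    ring

theorem tendsto_jacobiTheta_of_tendsto_im {α : Type*} {l : Filter α} {f : α → ℂ}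
    (hf : Tendsto (fun x => (f x).im) l atTop) :
    Tendsto (fun x => jacobiTheta (f x)) l (𝓝 1) := by
  have h1 : Tendsto f l (comap im atTop) := tendsto_comap_iff.mpr hf
  have h2 : Tendsto (fun τ : ℂ => Real.exp (-Real.pi * τ.im)) (comap im atTop) (𝓝 0) :=
    Real.tendsto_exp_atBot.comp
      ((tendsto_id.const_mul_atTop_of_neg (neg_lt_zero.mpr Real.pi_pos)).comp tendsto_comap)
  have h3 := (isBigO_at_im_infty_jacobiTheta_sub_one.trans_tendsto h2).comp h1
  simpa [Function.comp_def] using h3.add_const 1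

/-- The functional equation turns `ε → 0` into `1/(m²ε) → ∞`, where `cosKernel` tends to its
constant term `1`. The limit does not depend on `a`, so every residue class gets the same weight. -/
theorem tendsto_sqrt_mul_evenKernel (a : UnitAddCircle) {m : ℝ} (hm : 0 < m) :
    Tendsto (fun ε : ℝ => √ε * evenKernel a (m ^ 2 * ε)) (𝓝[>] 0) (𝓝 (1 / m)) := by
  have hcos : Tendsto (cosKernel a) atTop (𝓝 1) := by
    obtain ⟨p, hp, h⟩ := isBigO_atTop_cosKernel_sub a
    have h2 : Tendsto (fun x => Real.exp (-p * x)) atTop (𝓝 0) :=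
      Real.tendsto_exp_atBot.comp (tendsto_id.const_mul_atTop_of_neg (neg_lt_zero.mpr hp))
    simpa using (h.trans_tendsto h2).add_const 1
  have hinv : Tendsto (fun ε : ℝ => 1 / (m ^ 2 * ε)) (𝓝[>] 0) atTop := by
    have := tendsto_inv_nhdsGT_zero (𝕜 := ℝ) |>.const_mul_atTop (show 0 < 1 / m ^ 2 by positivity)
    refine this.congr fun ε => ?_
    rw [one_div, one_div, mul_inv]
  have h := (hcos.comp hinv).const_mul (1 / m)
  rw [mul_one] at h
  refine h.congr' ?_
  filter_upwards [self_mem_nhdsWithin] with ε (hε : 0 < ε)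
  rw [evenKernel_functional_equation, ← Real.sqrt_eq_rpow, Real.sqrt_mul (by positivity),
    Real.sqrt_sq hm.le, Function.comp]
  have := (Real.sqrt_pos.mpr hε).ne'
  field_simp

/-- A positive real factor leaves the argument unchanged, so no branch jump occurs. -/
theorem ofReal_mul_cpow {r : ℝ} (hr : 0 < r) {z : ℂ} (hz : z ≠ 0) (c : ℂ) :
    ((r : ℂ) * z) ^ c = (r : ℂ) ^ c * z ^ c := by
  have hr' : (r : ℂ) ≠ 0 := ofReal_ne_zero.mpr hr.ne'
  rw [cpow_def_of_ne_zero (mul_ne_zero hr' hz), cpow_def_of_ne_zero hr', cpow_def_of_ne_zero hz,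
    log_ofReal_mul hr hz, ← ofReal_log hr.le, add_mul, exp_add]

theorem ofReal_cpow_one_half {r : ℝ} (hr : 0 ≤ r) : (r : ℂ) ^ (1 / 2 : ℂ) = √r := by
  rw [Real.sqrt_eq_rpow, ofReal_cpow hr]
  norm_num

/-- The quadratic Gauss sum `∑ exp(πi r² / m)`, `r` modulo `m`, for even `m`. -/
theorem sum_exp_pi_mul_sq_div (m : ℕ) [NeZero m] (hm : Even m) :
    ∑ r : Fin m, cexp (Real.pi * I * ((r : ℕ) : ℂ) ^ 2 / m) = √m * cexp (Real.pi / 4 * I) := by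
  set S := ∑ r : Fin m, cexp (Real.pi * I * ((r : ℕ) : ℂ) ^ 2 / m) with hS
  have hm0 : (m : ℂ) ≠ 0 := Nat.cast_ne_zero.mpr (NeZero.ne m)
  have hmpos : (0 : ℝ) < m := Nat.cast_pos.mpr (NeZero.pos m)
  have hleft : Tendsto (fun ε : ℝ => (√ε : ℂ) * jacobiTheta (1 / m + I * ε)) (𝓝[>] 0)
      (𝓝 (S * (1 / m : ℝ))) := by
    have : Tendsto (fun ε : ℝ => ∑ r : Fin m, cexp (Real.pi * I * ((r : ℕ) : ℂ) ^ 2 / m) *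
        ((√ε * evenKernel (((r : ℕ) / m : ℝ) : UnitAddCircle) (m ^ 2 * ε) : ℝ) : ℂ)) (𝓝[>] 0)
        (𝓝 (S * (1 / m : ℝ))) := by
      rw [hS, Finset.sum_mul]
      refine tendsto_finsetSum _ fun r _ => Tendsto.const_mul _ ?_
      exact (continuous_ofReal.tendsto _).comp (tendsto_sqrt_mul_evenKernel _ hmpos)
    refine this.congr' ?_
    filter_upwards [self_mem_nhdsWithin] with ε (hε : 0 < ε)
    rw [jacobiTheta_eq_sum_evenKernel m hm hε, Finset.mul_sum]
    refine Finset.sum_congr rfl fun r _ => ?_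
    push_cast
    ring
  have hcont {z : ℝ → ℂ} {z₀ : ℂ} (hz : Tendsto z (𝓝[>] 0) (𝓝 z₀)) (hz₀ : z₀ ∈ slitPlane) :
      Tendsto (fun ε => z ε ^ (1 / 2 : ℂ)) (𝓝[>] 0) (𝓝 (z₀ ^ (1 / 2 : ℂ))) :=
    (continuousAt_cpow_const hz₀).tendsto.comp hz
  have hid : Tendsto (fun ε : ℝ => (ε : ℂ)) (𝓝[>] 0) (𝓝 0) :=
    (continuous_ofReal.tendsto' 0 0 ofReal_zero).mono_left nhdsWithin_le_nhds
  have h1 : Tendsto (fun ε : ℝ => (-I * (1 / m + I * ε)) ^ (1 / 2 : ℂ)) (𝓝[>] 0)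
      (𝓝 ((-I / m) ^ (1 / 2 : ℂ))) := by
    refine hcont ?_ ?_
    · have := ((hid.const_mul I).const_add (1 / m : ℂ)).const_mul (-I)
      convert this using 2
      ring
    · right
      simp [NeZero.ne m]
  have h2 : Tendsto (fun ε : ℝ => (m ^ 2 / (1 + m * I * ε)) ^ (1 / 2 : ℂ)) (𝓝[>] 0)
      (𝓝 ((m ^ 2 : ℂ) ^ (1 / 2 : ℂ))) := by
    refine hcont ?_ ?_
    · have := ((hid.const_mul (m * I)).const_add 1).inv₀ (by simp)
      simpa [div_eq_mul_inv] using this.const_mul (m ^ 2 : ℂ)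
    · left
      rw [← Nat.cast_pow, natCast_re, Nat.cast_pow]
      positivity
  have h3 : Tendsto (fun ε : ℝ => jacobiTheta (I / (m ^ 2 * ε) - 1 / m)) (𝓝[>] 0) (𝓝 1) := by
    refine tendsto_jacobiTheta_of_tendsto_im ?_
    have := tendsto_inv_nhdsGT_zero (𝕜 := ℝ) |>.const_mul_atTop (show 0 < 1 / (m : ℝ) ^ 2 by positivity)
    refine this.congr fun ε => ?_
    have e : (I / (m ^ 2 * ε) - 1 / m : ℂ) = ((1 / (m : ℝ) ^ 2 * ε⁻¹ : ℝ) : ℂ) * I - ((1 / m : ℝ) : ℂ) := by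
      push_cast
      ring
    rw [e, sub_im, im_ofReal_mul, ofReal_im, I_im, mul_one, sub_zero]
  -- Inversion, translation by the even integer `m`, and a second inversion carry `1/m + iε` to
  -- `i/(m²ε) - 1/m`, which moves up to `i∞`. The powers are the two automorphy factors, with `√ε`
  -- split off.
  have hkey : ∀ᶠ ε : ℝ in 𝓝[>] 0, (m ^ 2 / (1 + m * I * ε)) ^ (1 / 2 : ℂ) *
      (-I * (1 / m + I * ε)) ^ (1 / 2 : ℂ) * ((√ε : ℂ) * jacobiTheta (1 / m + I * ε)) =
      jacobiTheta (I / (m ^ 2 * ε) - 1 / m) := by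
    filter_upwards [self_mem_nhdsWithin] with ε (hε : 0 < ε)
    have hε0 : (ε : ℂ) ≠ 0 := by exact_mod_cast hε.ne'
    have hd : (1 + m * I * ε : ℂ) ≠ 0 := by
      intro h
      have := congrArg re h
      simp at this
    have hτ : (1 / m + I * ε : ℂ) = (1 + m * I * ε) / m := by field_simp
    have e1 := jacobiTheta_functional_equation (1 / m + I * ε)
    have e2 : (-1 / (1 / m + I * ε) : ℂ) = m ^ 2 * I * ε / (1 + m * I * ε) - m := by
      rw [hτ]
      field_simp
      ring
    rw [e2, jacobiTheta_sub_even_natCast _ hm,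
      jacobiTheta_functional_equation (m ^ 2 * I * ε / (1 + m * I * ε))] at e1
    have e3 : (-1 / (m ^ 2 * I * ε / (1 + m * I * ε)) : ℂ) = I / (m ^ 2 * ε) - 1 / m := by
      field_simp
      linear_combination (-1 : ℂ) * I_sq
    have e4 : (-I * (m ^ 2 * I * ε / (1 + m * I * ε))) ^ (1 / 2 : ℂ) =
        √ε * (m ^ 2 / (1 + m * I * ε)) ^ (1 / 2 : ℂ) := by
      have : (-I * (m ^ 2 * I * ε / (1 + m * I * ε)) : ℂ) = (ε : ℂ) * (m ^ 2 / (1 + m * I * ε)) := by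
        linear_combination (-(ε * m ^ 2 / (1 + m * I * ε)) : ℂ) * I_sq
      rw [this, ofReal_mul_cpow hε (by positivity), ofReal_cpow_one_half hε.le]
    have n1 : (-I * (1 / m + I * ε)) ^ (1 / 2 : ℂ) ≠ 0 := by
      rw [Ne, cpow_eq_zero_iff, hτ]
      simp [hd, hm0]
    have n2 : (m ^ 2 / (1 + m * I * ε)) ^ (1 / 2 : ℂ) ≠ 0 := by
      rw [Ne, cpow_eq_zero_iff]
      simp [hd, hm0]
    have n3 : (√ε : ℂ) ≠ 0 := by exact_mod_cast (Real.sqrt_pos.mpr hε).ne'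
    rw [e3, e4] at e1
    rw [e1]
    generalize (-I * (1 / m + I * ε)) ^ (1 / 2 : ℂ) = u at *
    generalize (m ^ 2 / (1 + m * I * ε)) ^ (1 / 2 : ℂ) = v at *
    generalize jacobiTheta (I / (m ^ 2 * ε) - 1 / m) = w at *
    field_simp
  -- The two limits give `m · (-i/m)^(1/2) · S/m = 1`.
  have hlim := tendsto_nhds_unique (((h2.mul h1).mul hleft).congr' hkey) h3
  have e5 : (m ^ 2 : ℂ) ^ (1 / 2 : ℂ) = m := by
    have := ofReal_cpow_one_half (sq_nonneg (m : ℝ))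
    rw [Real.sqrt_sq hmpos.le] at this
    exact_mod_cast this
  have e6 : (-I / m) ^ (1 / 2 : ℂ) = (√m : ℂ)⁻¹ * (cexp (Real.pi / 4 * I))⁻¹ := by
    have : (-I / m : ℂ) = ((m : ℝ)⁻¹ : ℝ) * (-I) := by
      push_cast
      ring
    rw [this, ofReal_mul_cpow (inv_pos.mpr hmpos) (by simp),
      ofReal_cpow_one_half (inv_pos.mpr hmpos).le, Real.sqrt_inv, ofReal_inv,
      cpow_def_of_ne_zero (by simp), log_neg_I, ← exp_neg]
    congr 2
    ring
  rw [e5, e6] at hlim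
  have n1 : (√m : ℂ) ≠ 0 := by exact_mod_cast (Real.sqrt_pos.mpr hmpos).ne'
  have n2 := exp_ne_zero (Real.pi / 4 * I)
  push_cast at hlim
  field_simp at hlim
  rw [hlim, mul_div_right_comm]

end QuadraticGaussSum

/-! ### Reduction of sums over finite abelian groups. -/

theorem sum_fiberwise_of_surjective {G T M : Type*} [AddGroup G] [Fintype G] [AddGroup T]
    [Fintype T] [AddCommMonoid M] (q : G →+ T) (hq : Function.Surjective q) (φ : T → M) :
    ∑ g, φ (q g) = Nat.card q.ker • ∑ t, φ t := by
  classical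
  rw [← Finset.sum_fiberwise Finset.univ q, Finset.smul_sum]
  refine Finset.sum_congr rfl fun t _ => ?_
  rw [Finset.sum_congr rfl (g := fun _ => φ t) (fun g hg => by rw [(Finset.mem_filter.mp hg).2]),
    Finset.sum_const, AddMonoidHom.card_fiber_eq_of_mem_range q (hq t) (hq 0)]
  congr 1
  rw [Nat.card_eq_fintype_card, Fintype.card_subtype]
  simp only [AddMonoidHom.mem_ker]

/-- If `φ'` transforms by non-trivial characters of `ker q` outside the subgroup `R`, and is
induced from `φ` through `q` on `R`, then the sum of `φ'` reduces to the sum of `φ`. -/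
theorem sum_eq_card_ker_mul_sum {T' T : Type*} [AddCommGroup T'] [Fintype T'] [AddCommGroup T]
    [Fintype T] (R : AddSubgroup T') (q : R →+ T) (hq : Function.Surjective q)
    (φ' : T' → ℂ) (φ : T → ℂ) (hφ : ∀ r, φ (q r) = φ' r) (χ : T' → AddChar q.ker ℂ)
    (hχ : ∀ x (h : q.ker), φ' (x + (h : R)) = χ x h * φ' x) (hR : ∀ x, x ∉ R → χ x ≠ 0) :
    ∑ x, φ' x = Nat.card q.ker * ∑ t, φ t := by
  classical
  have hout : ∑ x with x ∉ R, φ' x = 0 := by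
    -- Translation by `h ∈ ker q ⊆ R` permutes the complement of `R`. Summing over all `h` then
    -- brings in full sums of the characters `χ x`, which vanish; in `AddChar`, `0` is the trivial
    -- character.
    have hshift (h : q.ker) : ∑ x with x ∉ R, χ x h * φ' x = ∑ x with x ∉ R, φ' x := by
      simp only [← hχ]
      refine Finset.sum_equiv (Equiv.addRight ((h : R) : T')) (fun x => ?_) (fun x _ => rfl)
      simp only [Finset.mem_filter, Finset.mem_univ, true_and, Equiv.coe_addRight]
      rw [AddSubgroup.add_mem_cancel_right R (h : R).2]
    have h1 : ∑ h : q.ker, ∑ x with x ∉ R, χ x h * φ' x = 0 := by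
      rw [Finset.sum_comm]
      refine Finset.sum_eq_zero fun x hx => ?_
      rw [← Finset.sum_mul, AddChar.sum_eq_ite, if_neg (hR x (Finset.mem_filter.mp hx).2), zero_mul]
    simp only [hshift, Finset.sum_const, Finset.card_univ, nsmul_eq_mul] at h1
    exact (mul_eq_zero.mp h1).resolve_left (Nat.cast_ne_zero.mpr Fintype.card_ne_zero)
  rw [← Finset.sum_filter_add_sum_filter_not Finset.univ (· ∈ R), hout, add_zero, ← nsmul_eq_mul,
    ← sum_fiberwise_of_surjective q hq, Finset.sum_congr rfl fun r _ => hφ r]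
  exact Finset.sum_subtype _ (fun x => by simp) φ'

/-! ### The standard character of `ℚ/ℤ`. -/

/-- The character `t ↦ exp(2πi t)` of `ℚ/ℤ`. -/
noncomputable def ratChar : AddChar (AddCircle (1 : ℚ)) ℂ where
  toFun t := (ratToReal t).toCircle
  map_zero_eq_one' := by simp
  map_add_eq_mul' s t := by simp [AddCircle.toCircle_add]

theorem ratChar_apply (t : AddCircle (1 : ℚ)) : ratChar t = ((ratToReal t).toCircle : ℂ) := rfl

theorem ratChar_coe (q : ℚ) : ratChar (q : AddCircle (1 : ℚ)) = Complex.exp (2 * Real.pi * Complex.I * q) := by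
  rw [ratChar_apply, ratToReal_coe, AddCircle.toCircle_apply_mk, Circle.coe_exp]
  congr 1
  push_cast
  ring

theorem coe_eq_zero_iff_exists_int {q : ℚ} : (q : AddCircle (1 : ℚ)) = 0 ↔ ∃ n : ℤ, q = n := by
  rw [AddCircle.coe_eq_zero_iff]
  simp [eq_comm]

theorem ratChar_eq_one_iff {t : AddCircle (1 : ℚ)} : ratChar t = 1 ↔ t = 0 := by
  refine ⟨fun h => ?_, fun h => by rw [h, AddChar.map_zero_eq_one]⟩
  induction t using QuotientAddGroup.induction_on with | _ q
  rw [ratChar_coe, Complex.exp_eq_one_iff] at h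
  obtain ⟨n, hn⟩ := h
  refine coe_eq_zero_iff_exists_int.mpr ⟨n, ?_⟩
  have h0 : (2 * Real.pi * Complex.I : ℂ) ≠ 0 := Complex.two_pi_I_ne_zero
  rw [mul_comm] at hn
  exact_mod_cast mul_right_cancel₀ h0 hn

/-! ### Integral and even lattices, and the forms induced on `L^#/L`. -/

variable {V : Type*} [AddCommGroup V] [Module ℚ V]

theorem IsIntegral.le_dual {B : LinearMap.BilinForm ℚ V} {L : Submodule ℤ V}
    (h : IsIntegral B L) : L ≤ dual B L :=
  fun x hx => mem_dual.mpr fun y hy => h x hx y hy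

theorem IsEven.isIntegral {B : LinearMap.BilinForm ℚ V} (hB : B.IsSymm) {L : Submodule ℤ V}
    (h : IsEven B L) : IsIntegral B L := by
  intro x hx y hy
  obtain ⟨a, ha⟩ := h x hx
  obtain ⟨b, hb⟩ := h y hy
  obtain ⟨c, hc⟩ := h (x + y) (L.add_mem hx hy)
  -- Polarization: `B(x, y) = Q(x + y) - Q(x) - Q(y)`.
  refine ⟨c - a - b, ?_⟩
  simp only [map_add, LinearMap.add_apply, hB.eq y x] at hc
  push_cast
  rw [← ha, ← hb, ← hc]
  ring

/-- The pairing `L^# × L^# → ℚ/ℤ` induced by `B`. -/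
noncomputable def dualPairing (B : LinearMap.BilinForm ℚ V) (L : Submodule ℤ V) :
    dual B L →ₗ[ℤ] dual B L →ₗ[ℤ] AddCircle (1 : ℚ) :=
  LinearMap.mk₂ ℤ (fun x y => ((B x y : ℚ) : AddCircle (1 : ℚ)))
    (by simp) (by simp) (by simp) (by simp)

theorem Discr.mk_surjective (B : LinearMap.BilinForm ℚ V) (L : Submodule ℤ V) :
    Function.Surjective (Discr.mk B L) :=
  Submodule.Quotient.mk_surjective _

/-- The bilinear form `b_L` on the discriminant group. -/
noncomputable def discrBilin (B : LinearMap.BilinForm ℚ V) (hB : B.IsSymm) (L : Submodule ℤ V) :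
    Discr B L →ₗ[ℤ] Discr B L →ₗ[ℤ] AddCircle (1 : ℚ) :=
  Submodule.liftQ _ (Submodule.liftQ (L.submoduleOf (dual B L)) (dualPairing B L) (by
    intro x hx
    ext y
    rw [dualPairing, LinearMap.mk₂_apply, LinearMap.zero_apply, coe_eq_zero_iff_exists_int, hB.eq]
    exact mem_dual.mp y.2 x hx)).flip (by
    intro x hx
    refine LinearMap.ext fun s => ?_
    obtain ⟨y, rfl⟩ := Discr.mk_surjective B L s
    change ((B y x : ℚ) : AddCircle (1 : ℚ)) = 0
    rw [coe_eq_zero_iff_exists_int]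
    exact mem_dual.mp y.2 x hx)

theorem discrBilin_mk (B : LinearMap.BilinForm ℚ V) (hB : B.IsSymm) (L : Submodule ℤ V)
    (x y : dual B L) :
    discrBilin B hB L (Discr.mk B L x) (Discr.mk B L y) = ((B x y : ℚ) : AddCircle (1 : ℚ)) := by
  -- Descending twice with a `flip` in between exchanges the arguments, so symmetry has to restore
  -- their order.
  rw [← hB.eq]
  rfl

theorem Discr.mk_eq_mk {B : LinearMap.BilinForm ℚ V} {L : Submodule ℤ V} {x y : dual B L} :
    Discr.mk B L x = Discr.mk B L y ↔ (x - y : V) ∈ L := by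
  rw [Discr.mk, Submodule.Quotient.eq]
  rfl

theorem Discr.mk_eq_zero {B : LinearMap.BilinForm ℚ V} {L : Submodule ℤ V} {x : dual B L} :
    Discr.mk B L x = 0 ↔ (x : V) ∈ L := by
  rw [Discr.mk, Submodule.Quotient.mk_eq_zero]
  rfl

/-- The function underlying `ψ_L`. -/
noncomputable def discrFun (B : LinearMap.BilinForm ℚ V) (hB : B.IsSymm) (L : Submodule ℤ V)
    (hL : IsEven B L) : Discr B L → AddCircle (1 : ℚ) :=
  Quotient.lift (fun x : dual B L => ((B x x / 2 : ℚ) : AddCircle (1 : ℚ))) (by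
    intro x y hxy
    have hxy' : (x - y : V) ∈ L := Discr.mk_eq_mk.mp (Quotient.sound hxy)
    obtain ⟨m, hm⟩ := hL _ hxy'
    obtain ⟨n, hn⟩ := mem_dual.mp y.2 _ hxy'
    refine sub_eq_zero.mp ?_
    rw [← AddCircle.coe_sub, coe_eq_zero_iff_exists_int]
    -- `Q(x) - Q(y) = Q(x - y) + B(y, x - y)`.
    refine ⟨m + n, ?_⟩
    push_cast
    rw [← hm, ← hn]
    simp only [map_sub, LinearMap.sub_apply, hB.eq x y]
    ring)

theorem discrFun_mk (B : LinearMap.BilinForm ℚ V) (hB : B.IsSymm) (L : Submodule ℤ V)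
    (hL : IsEven B L) (x : dual B L) :
    discrFun B hB L hL (Discr.mk B L x) = ((B x x / 2 : ℚ) : AddCircle (1 : ℚ)) := rfl

theorem discrFun_add (B : LinearMap.BilinForm ℚ V) (hB : B.IsSymm) (L : Submodule ℤ V)
    (hL : IsEven B L) (s t : Discr B L) :
    discrFun B hB L hL (s + t) =
      discrFun B hB L hL s + discrFun B hB L hL t + discrBilin B hB L s t := by
  obtain ⟨x, rfl⟩ := Discr.mk_surjective B L s
  obtain ⟨y, rfl⟩ := Discr.mk_surjective B L t
  rw [discrBilin_mk, discrFun_mk, discrFun_mk, Discr.mk, Discr.mk, ← Submodule.Quotient.mk_add,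
    discrFun_mk, ← AddCircle.coe_add, ← AddCircle.coe_add]
  congr 1
  simp only [Submodule.coe_add, map_add, LinearMap.add_apply, hB.eq y x]
  ring

/-- The quadratic function `ψ_L` on the discriminant group of an even lattice. -/
noncomputable def discrQuad (B : LinearMap.BilinForm ℚ V) (hB : B.IsSymm) (L : Submodule ℤ V)
    (hL : IsEven B L) : QuadraticMap ℤ (Discr B L) (AddCircle (1 : ℚ)) where
  toFun := discrFun B hB L hL
  toFun_smul a t := by
    obtain ⟨x, rfl⟩ := Discr.mk_surjective B L t
    rw [Discr.mk, ← Submodule.Quotient.mk_smul, discrFun_mk, discrFun_mk, ← AddCircle.coe_zsmul]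
    congr 1
    simp
    ring
  exists_companion' := ⟨discrBilin B hB L, discrFun_add B hB L hL⟩

theorem discrQuad_mk (B : LinearMap.BilinForm ℚ V) (hB : B.IsSymm) (L : Submodule ℤ V)
    (hL : IsEven B L) (x : dual B L) :
    discrQuad B hB L hL (Discr.mk B L x) = ((B x x / 2 : ℚ) : AddCircle (1 : ℚ)) := rfl

theorem discrQuad_add (B : LinearMap.BilinForm ℚ V) (hB : B.IsSymm) (L : Submodule ℤ V)
    (hL : IsEven B L) (s t : Discr B L) :
    discrQuad B hB L hL (s + t) =
      discrQuad B hB L hL s + discrQuad B hB L hL t + discrBilin B hB L s t :=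
  discrFun_add B hB L hL s t

/-! ### Biduality, finiteness and non-singularity. -/

theorem exists_basis_span_eq {L : Submodule ℤ V} (hL : L.IsLattice ℚ) :
    ∃ (n : ℕ) (v : Module.Basis (Fin n) ℚ V), Submodule.span ℤ (Set.range v) = L := by
  have : Module.Free ℤ L := Submodule.IsLattice.free ℚ L
  have : Module.Finite ℤ L := Module.Finite.iff_fg.mpr hL.fg
  let b := Module.finBasis ℤ L
  refine ⟨_, b.extendOfIsLattice ℚ, ?_⟩
  have : Set.range (b.extendOfIsLattice ℚ) = L.subtype '' Set.range b := by
    rw [← Set.range_comp]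
    exact congrArg Set.range (funext fun k => by simp)
  rw [this, Submodule.span_image, b.span_eq, Submodule.map_top, Submodule.range_subtype]

theorem dual_dual {B : LinearMap.BilinForm ℚ V} (hB : B.IsSymm) (hB' : B.Nondegenerate)
    {L : Submodule ℤ V} (hL : L.IsLattice ℚ) : dual B (dual B L) = L := by
  obtain ⟨n, v, rfl⟩ := exists_basis_span_eq hL
  exact LinearMap.BilinForm.dualSubmodule_dualSubmodule_of_basis B hB' hB v

theorem exists_nsmul_mem {L : Submodule ℤ V} (hL : L.IsLattice ℚ) (x : V) :
    ∃ n : ℕ, n ≠ 0 ∧ (n : ℤ) • x ∈ L := by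
  have hx : x ∈ Submodule.span ℚ (L : Set V) := hL.span_eq_top ▸ Submodule.mem_top
  induction hx using Submodule.span_induction with
  | mem x hx => exact ⟨1, one_ne_zero, L.smul_mem _ hx⟩
  | zero => exact ⟨1, one_ne_zero, by simp⟩
  | add x y _ _ hx hy =>
    obtain ⟨m, hm, hmx⟩ := hx
    obtain ⟨n, hn, hny⟩ := hy
    refine ⟨m * n, mul_ne_zero hm hn, ?_⟩
    rw [smul_add]
    refine L.add_mem ?_ ?_
    · rw [Nat.cast_mul, mul_comm, mul_smul]
      exact L.smul_mem _ hmx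
    · rw [Nat.cast_mul, mul_smul]
      exact L.smul_mem _ hny
  | smul q x _ hx =>
    obtain ⟨m, hm, hmx⟩ := hx
    refine ⟨q.den * m, mul_ne_zero q.den_ne_zero hm, ?_⟩
    have : ((q.den * m : ℕ) : ℤ) • q • x = q.num • (m : ℤ) • x := by
      rw [← Int.cast_smul_eq_zsmul ℚ, ← Int.cast_smul_eq_zsmul ℚ, ← Int.cast_smul_eq_zsmul ℚ,
        smul_smul, smul_smul]
      congr 1
      push_cast
      rw [mul_right_comm, Rat.den_mul_eq_num]
    rw [this]
    exact L.smul_mem _ hmx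

/-- The dual basis generates `L^#`, and every vector has a non-zero integral multiple in `L`; a
finitely generated torsion group is finite. -/
theorem finite_discr {B : LinearMap.BilinForm ℚ V} (hB' : B.Nondegenerate)
    {L : Submodule ℤ V} (hL : L.IsLattice ℚ) : Finite (Discr B L) := by
  have hfg : (dual B L).FG := by
    obtain ⟨n, v, rfl⟩ := exists_basis_span_eq hL
    rw [dual, LinearMap.BilinForm.dualSubmodule_span_of_basis B hB' v]
    exact Submodule.fg_span (Set.finite_range _)
  have : Module.Finite ℤ (dual B L) := Module.Finite.iff_fg.mpr hfg
  refine Module.finite_of_fg_torsion _ fun {t} => ?_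
  obtain ⟨x, rfl⟩ := Discr.mk_surjective B L t
  obtain ⟨n, hn, hx⟩ := exists_nsmul_mem hL (x : V)
  refine ⟨⟨n, mem_nonZeroDivisors_of_ne_zero (by exact_mod_cast hn)⟩, ?_⟩
  exact (Discr.mk_eq_zero (x := (n : ℤ) • x)).mpr hx

/-- A class in the radical is represented by a vector pairing integrally with `L^#`, that is, by an
element of `L^## = L`. -/
theorem isNonsingular_discrQuad {B : LinearMap.BilinForm ℚ V} (hB : B.IsSymm)
    (hB' : B.Nondegenerate) {L : Submodule ℤ V} (hL : L.IsLattice ℚ) (hE : IsEven B L) :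
    IsNonsingular (discrQuad B hB L hE) := by
  intro s hs
  obtain ⟨x, rfl⟩ := Discr.mk_surjective B L s
  refine Discr.mk_eq_zero.mpr ((dual_dual hB hB' hL).le (mem_dual.mpr ?_))
  intro y hy
  have := hs (Discr.mk B L ⟨y, hy⟩)
  rw [QuadraticMap.polar, discrQuad_add, add_assoc, add_sub_cancel_left, add_sub_cancel_left,
    discrBilin_mk, coe_eq_zero_iff_exists_int] at this
  exact this

/-! ### Passage to a sublattice. -/

theorem dual_antitone (B : LinearMap.BilinForm ℚ V) {L' L : Submodule ℤ V} (h : L' ≤ L) :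
    dual B L ≤ dual B L' :=
  fun _ hx => mem_dual.mpr fun l hl => mem_dual.mp hx l (h hl)

theorem IsEven.mono {B : LinearMap.BilinForm ℚ V} {L' L : Submodule ℤ V} (h : L' ≤ L)
    (hL : IsEven B L) : IsEven B L' :=
  fun x hx => hL x (h hx)

/-- `sum_eq_card_ker_mul_sum` is applied to `R = L^#/L'` inside `L'^#/L'` and to the projection `R →
L^#/L`, whose kernel is `L/L'`. On this kernel `ψ_{L'}` vanishes, so a shift by `h` multiplies the
term at `x` by the character value of `b(x, h)`. -/
theorem sum_discrQuad_sublattice {B : LinearMap.BilinForm ℚ V} (hB : B.IsSymm)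
    {L' L : Submodule ℤ V} (hle : L' ≤ L) (hE : IsEven B L) [Fintype (Discr B L')]
    [Fintype (Discr B L)] :
    ∃ c : ℕ, ∑ s, ratChar (discrQuad B hB L' (hE.mono hle) s) =
      c * ∑ t, ratChar (discrQuad B hB L hE t) := by
  let incl : dual B L →ₗ[ℤ] dual B L' := Submodule.inclusion (dual_antitone B hle)
  let ι : dual B L →+ Discr B L' :=
    ((Submodule.mkQ (L'.submoduleOf (dual B L'))).comp incl).toAddMonoidHom
  have hι (a : dual B L) : ι a = Discr.mk B L' (incl a) := rfl
  let π : dual B L →+ Discr B L := (Submodule.mkQ (L.submoduleOf (dual B L))).toAddMonoidHom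
  have hπ (a : dual B L) : π a = Discr.mk B L a := rfl
  have hker : ι.rangeRestrict.ker ≤ π.ker := by
    intro a ha
    rw [AddMonoidHom.ker_rangeRestrict, AddMonoidHom.mem_ker, hι, Discr.mk_eq_zero] at ha
    rw [AddMonoidHom.mem_ker, hπ, Discr.mk_eq_zero]
    exact hle ha
  let q : ι.range →+ Discr B L :=
    ι.rangeRestrict.liftOfSurjective ι.rangeRestrict_surjective ⟨π, hker⟩
  have hq (a : dual B L) : q (ι.rangeRestrict a) = Discr.mk B L a :=
    AddMonoidHom.liftOfRightInverse_comp_apply _ _ _ ⟨π, hker⟩ a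
  have hφ (r : ι.range) :
      ratChar (discrQuad B hB L hE (q r)) = ratChar (discrQuad B hB L' (hE.mono hle) r) := by
    obtain ⟨a, rfl⟩ := ι.rangeRestrict_surjective r
    rw [hq]
    rfl
  refine ⟨_, sum_eq_card_ker_mul_sum ι.range q (fun t => ?_) _ _ hφ
    (fun x => ratChar.compAddMonoidHom ((discrBilin B hB L' x).toAddMonoidHom.comp
      (ι.range.subtype.comp q.ker.subtype))) ?_ ?_⟩
  · obtain ⟨a, rfl⟩ := Discr.mk_surjective B L t
    exact ⟨_, hq a⟩
  · intro x h
    have hh : ratChar (discrQuad B hB L' (hE.mono hle) (h : ι.range)) = 1 := by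
      rw [← hφ, (AddMonoidHom.mem_ker).mp h.2, QuadraticMap.map_zero, AddChar.map_zero_eq_one]
    rw [discrQuad_add, AddChar.map_add_eq_mul, AddChar.map_add_eq_mul, hh, mul_one, mul_comm]
    rfl
  · intro x hx hχ
    obtain ⟨v, rfl⟩ := Discr.mk_surjective B L' x
    -- If the character of `v` is trivial on `L/L'`, then `v` pairs integrally with `L`, so its
    -- class lies in `R`.
    refine hx ⟨⟨v, mem_dual.mpr fun l hl => ?_⟩, rfl⟩
    have hl' : l ∈ dual B L := (hE.isIntegral hB).le_dual hl
    have hmem : ι.rangeRestrict ⟨l, hl'⟩ ∈ q.ker := by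
      rw [AddMonoidHom.mem_ker, hq, Discr.mk_eq_zero]
      exact hl
    have h1 := DFunLike.congr_fun hχ ⟨_, hmem⟩
    rw [AddChar.zero_apply] at h1
    have h2 := ratChar_eq_one_iff.mp h1
    exact coe_eq_zero_iff_exists_int.mp ((discrBilin_mk B hB L' v (incl ⟨l, hl'⟩)).symm.trans h2)

/-! ### Diagonal even lattices. -/

open Complex in
-- This is the sum for `m = 2|a|`, since `πi k²/m = 2πi k²/(4|a|)`; negative `a` follows by complex
-- conjugation.
theorem sum_exp_pi_mul_sq_div_int (a : ℤ) (ha : a ≠ 0) :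
    ∑ k : Fin (2 * a.natAbs), cexp (2 * Real.pi * I * (((k : ℕ) ^ 2 / (4 * a) : ℚ) : ℂ)) =
      √(2 * a.natAbs : ℕ) * cexp (2 * Real.pi * I * ((a.sign / 8 : ℚ) : ℂ)) := by
  have : NeZero (2 * a.natAbs) := ⟨by simpa using ha⟩
  have h := sum_exp_pi_mul_sq_div (2 * a.natAbs) (even_two_mul _)
  have haC : (a : ℂ) ≠ 0 := by exact_mod_cast ha
  rcases lt_or_gt_of_ne ha with hneg | hpos
  · have hc := congrArg (starRingEnd ℂ) h
    rw [map_sum, map_mul, conj_ofReal, ← exp_conj] at hc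
    convert hc using 2
    · rw [← exp_conj]
      congr 1
      have : (a.natAbs : ℂ) = -a := by
        rw [← Int.cast_natCast, Int.ofNat_natAbs_of_nonpos hneg.le, Int.cast_neg]
      simp [this, map_ofNat]
      field_simp
      ring
    · rw [Int.sign_eq_neg_one_of_neg hneg]
      congr 1
      simp [map_ofNat]
      ring
  · convert h using 2
    · have : (a.natAbs : ℂ) = a := by
        rw [← Int.cast_natCast, Int.natAbs_of_nonneg hpos.le]
      push_cast
      rw [this]
      congr 1
      field_simp
      ring
    · rw [Int.sign_eq_one_of_pos hpos]
      congr 1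
      push_cast
      ring

/-- `v` is an orthogonal basis with `B(vᵢ, vᵢ) = 2 aᵢ` for non-zero integers `aᵢ`. -/
structure IsEvenDiagonal {ι : Type*} (B : LinearMap.BilinForm ℚ V) (v : Module.Basis ι ℚ V)
    (a : ι → ℤ) : Prop where
  ortho : ∀ i j, i ≠ j → B (v i) (v j) = 0
  self : ∀ i, B (v i) (v i) = 2 * a i
  ne_zero : ∀ i, a i ≠ 0

theorem exists_isEvenDiagonal {B : LinearMap.BilinForm ℚ V} (hB : B.IsSymm)
    (hB' : B.Nondegenerate) {L : Submodule ℤ V} (hL : L.IsLattice ℚ) (hE : IsEven B L) :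
    ∃ (n : ℕ) (v : Module.Basis (Fin n) ℚ V) (a : Fin n → ℤ),
      IsEvenDiagonal B v a ∧ Submodule.span ℤ (Set.range v) ≤ L := by
  obtain ⟨_, v₀, _⟩ := exists_basis_span_eq hL
  have : FiniteDimensional ℚ V := v₀.finiteDimensional_of_finite
  obtain ⟨v, hv⟩ := LinearMap.BilinForm.exists_orthogonal_basis (B := B) ⟨hB.eq⟩
  -- Scaling each vector into `L` keeps orthogonality, and evenness of `L` makes half of each square
  -- an integer.
  choose m hm hmv using fun i => exists_nsmul_mem hL (v i)
  have hm' (i) : (m i : ℚ) ≠ 0 := Nat.cast_ne_zero.mpr (hm i)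
  let w := v.unitsSMul fun i => Units.mk0 (m i : ℚ) (hm' i)
  have hw (i) : w i = (m i : ℚ) • v i := by
    rw [Module.Basis.unitsSMul_apply]
    rfl
  have hwL (i) : w i ∈ L := by
    rw [hw, Nat.cast_smul_eq_nsmul, ← natCast_zsmul]
    exact hmv i
  choose a ha using fun i => hE _ (hwL i)
  have hortho (i j) (hij : i ≠ j) : B (w i) (w j) = 0 := by
    have : B (v i) (v j) = 0 := LinearMap.isOrthoᵢ_def.mp hv i j hij
    simp [hw, this]
  refine ⟨_, w, a, ⟨hortho, fun i => by rw [← ha]; ring, fun i hi => ?_⟩, ?_⟩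
  · refine LinearMap.BilinForm.iIsOrtho.not_isOrtho_basis_self_of_nondegenerate (v := w)
      (LinearMap.isOrthoᵢ_def.mpr hortho) hB' i ?_
    have := ha i
    rw [hi] at this
    simpa using this
  · rw [Submodule.span_le]
    rintro _ ⟨i, rfl⟩
    exact hwL i

namespace IsEvenDiagonal

variable {ι : Type*} {B : LinearMap.BilinForm ℚ V} {v : Module.Basis ι ℚ V} {a : ι → ℤ}

theorem apply_basis (h : IsEvenDiagonal B v a) (x : V) (i : ι) :
    B x (v i) = 2 * a i * v.repr x i := by
  have : B.flip (v i) = (2 * a i : ℚ) • v.coord i := by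
    refine v.ext fun j => ?_
    rcases eq_or_ne j i with rfl | hij
    · simp [h.self]
    · simp [h.ortho j i hij, Finsupp.single_eq_of_ne hij.symm]
  simpa using LinearMap.congr_fun this x

theorem apply_self [Fintype ι] (h : IsEvenDiagonal B v a) (x : V) :
    B x x = ∑ i, 2 * a i * (v.repr x i * v.repr x i) := by
  nth_rw 2 [← v.sum_repr x]
  rw [map_sum]
  refine Finset.sum_congr rfl fun i _ => ?_
  rw [map_smul, h.apply_basis, smul_eq_mul]
  ring

theorem mem_dual_iff [Fintype ι] {x : V} :
    x ∈ dual B (Submodule.span ℤ (Set.range v)) ↔ ∀ i, ∃ n : ℤ, B x (v i) = n := by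
  rw [mem_dual]
  refine ⟨fun h i => h _ (Submodule.subset_span ⟨i, rfl⟩), fun h l hl => ?_⟩
  rw [Module.Basis.mem_span_iff_repr_mem] at hl
  choose c hc using hl
  choose n hn using h
  refine ⟨∑ i, c i * n i, ?_⟩
  rw [← v.sum_repr l, map_sum]
  push_cast
  refine Finset.sum_congr rfl fun i _ => ?_
  rw [map_smul, hn, ← hc]
  rfl

/-- By Sylvester's law the signature counts the signs of the weights `2aᵢ` in the diagonal
coordinates. -/
theorem signature_eq [Fintype ι] (h : IsEvenDiagonal B v a) : signature B = ∑ i, (a i).sign := by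
  have e : QuadraticMap.Equivalent (LinearMap.BilinMap.toQuadraticMap B)
      (QuadraticMap.weightedSumSquares ℚ fun i => (2 * a i : ℚ)) :=
    ⟨{ v.equivFun with
      map_app' := fun x => by
        rw [LinearMap.BilinMap.toQuadraticMap_apply, h.apply_self,
          QuadraticMap.weightedSumSquares_apply]
        rfl }⟩
  rw [signature, QuadraticForm.sigPos_of_equiv_weightedSumSquares e,
    QuadraticForm.sigNeg_of_equiv_weightedSumSquares e]
  classical
  rw [Set.ncard_eq_toFinset_card', Set.ncard_eq_toFinset_card']
  simp only [Set.toFinset_ofPred, Finset.natCast_card_filter, ← Finset.sum_sub_distrib]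
  refine Finset.sum_congr rfl fun i _ => ?_
  rcases lt_trichotomy (a i) 0 with hi | hi | hi
  · have hi' : (a i : ℚ) < 0 := by exact_mod_cast hi
    rw [Int.sign_eq_neg_one_of_neg hi, if_neg (by linarith), if_pos (by linarith)]
    rfl
  · exact absurd hi (h.ne_zero i)
  · have hi' : (0 : ℚ) < a i := by exact_mod_cast hi
    rw [Int.sign_eq_one_of_pos hi, if_pos (by linarith), if_neg (by linarith)]
    rfl

open Complex in
theorem sum_discrQuad [Fintype ι] (h : IsEvenDiagonal B v a) (hB : B.IsSymm)
    (hE : IsEven B (Submodule.span ℤ (Set.range v)))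
    [Fintype (Discr B (Submodule.span ℤ (Set.range v)))] :
    ∑ t, ratChar (discrQuad B hB _ hE t) = (∏ i, √(2 * (a i).natAbs : ℕ) : ℝ) *
      cexp (2 * Real.pi * I * ((signature B / 8 : ℚ) : ℂ)) := by
  classical
  have ha (i) : (a i : ℚ) ≠ 0 := Int.cast_ne_zero.mpr (h.ne_zero i)
  -- The coordinates `kᵢ/(2aᵢ)` make `B(x k, vᵢ) = kᵢ`. With `0 ≤ kᵢ < 2|aᵢ|` these vectors
  -- represent each class of the dual modulo the lattice exactly once.
  let x (k : ∀ i, Fin (2 * (a i).natAbs)) : V :=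
    v.equivFun.symm fun i => ((k i : ℕ) / (2 * a i) : ℚ)
  have hx (k) (i) : v.repr (x k) i = (k i : ℕ) / (2 * a i) := by
    rw [← v.equivFun_apply, LinearEquiv.apply_symm_apply]
  have hxv (k) (i) : B (x k) (v i) = (k i : ℕ) := by
    rw [h.apply_basis, hx]
    have := ha i
    field_simp
  have hxd (k) : x k ∈ dual B (Submodule.span ℤ (Set.range v)) :=
    mem_dual_iff.mpr fun i => ⟨(k i : ℕ), by rw [hxv]; rfl⟩
  let f (k : ∀ i, Fin (2 * (a i).natAbs)) : Discr B (Submodule.span ℤ (Set.range v)) :=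
    Discr.mk B _ ⟨x k, hxd k⟩
  have hf : Function.Bijective f := by
    constructor
    · intro k l hkl
      have hmem := Discr.mk_eq_mk.mp hkl
      rw [Module.Basis.mem_span_iff_repr_mem] at hmem
      funext i
      obtain ⟨c, hc⟩ := hmem i
      simp only [map_sub, Finsupp.sub_apply, hx, eq_intCast] at hc
      have hai := ha i
      have hc' : ((k i : ℕ) : ℤ) - ((l i : ℕ) : ℤ) = 2 * a i * c := by
        field_simp at hc
        have hc'' : ((k i : ℕ) : ℚ) - ((l i : ℕ) : ℚ) = 2 * a i * c := by linarith
        exact_mod_cast hc''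
      have hmod : (k i : ℕ) ≡ (l i : ℕ) [MOD 2 * (a i).natAbs] := by
        rw [Nat.modEq_iff_dvd]
        push_cast
        rw [← neg_sub, hc', dvd_neg]
        exact (mul_dvd_mul_left 2 ((abs_dvd _ _).mpr dvd_rfl)).trans (dvd_mul_right _ _)
      exact Fin.ext (Nat.ModEq.eq_of_lt_of_lt hmod (k i).2 (l i).2)
    · intro t
      obtain ⟨y, rfl⟩ := Discr.mk_surjective B _ t
      choose m hm using mem_dual_iff.mp y.2
      have hpos (i) : 0 < 2 * (a i).natAbs := by
        have := Int.natAbs_pos.mpr (h.ne_zero i)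
        omega
      have hne (i) : ((2 * (a i).natAbs : ℕ) : ℤ) ≠ 0 := by exact_mod_cast (hpos i).ne'
      -- Reducing `mᵢ = B(y, vᵢ)` modulo `2|aᵢ|` changes the `i`-th coordinate of `y` by an integer.
      refine ⟨fun i => ⟨(m i % (2 * (a i).natAbs : ℕ)).toNat, ?_⟩, ?_⟩
      · have := Int.emod_lt_of_pos (m i) (Int.natCast_pos.mpr (hpos i))
        have := Int.emod_nonneg (m i) (hne i)
        omega
      · refine Discr.mk_eq_mk.mpr ?_
        rw [Module.Basis.mem_span_iff_repr_mem]
        intro i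
        have hdvd : 2 * a i ∣ m i % (2 * (a i).natAbs : ℕ) - m i := by
          have h1 : ((2 * (a i).natAbs : ℕ) : ℤ) ∣ m i % (2 * (a i).natAbs : ℕ) - m i :=
            ⟨-(m i / (2 * (a i).natAbs : ℕ)), by
              linarith [Int.emod_add_mul_ediv (m i) (2 * (a i).natAbs : ℕ)]⟩
          refine Dvd.dvd.trans ?_ h1
          push_cast
          exact mul_dvd_mul_left 2 ((dvd_abs _ _).mpr dvd_rfl)
        obtain ⟨c, hc⟩ := hdvd
        refine ⟨c, ?_⟩
        have hy : v.repr (y : V) i = m i / (2 * a i) := by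
          have := h.apply_basis y i
          rw [hm] at this
          have := ha i
          field_simp
          linarith
        simp only [map_sub, Finsupp.sub_apply, hx, eq_intCast, hy]
        have h0 : (((m i % (2 * (a i).natAbs : ℕ)).toNat : ℕ) : ℚ) =
            ((m i % (2 * (a i).natAbs : ℕ) : ℤ) : ℚ) := by
          rw [← Int.cast_natCast, Int.toNat_of_nonneg (Int.emod_nonneg _ (hne i))]
        have hc' : ((m i % (2 * (a i).natAbs : ℕ) : ℤ) : ℚ) - m i = 2 * a i * c := by
          exact_mod_cast hc
        rw [h0, ← sub_div, hc']
        have := ha i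
        field_simp
  rw [← hf.sum_comp fun t => ratChar (discrQuad B hB _ hE t)]
  -- `Q(x k) = ∑ kᵢ²/(4aᵢ)`, so the exponential factors and the sum over tuples becomes a product of
  -- one-dimensional sums.
  have hterm (k) : ratChar (discrQuad B hB _ hE (f k)) =
      ∏ i, cexp (2 * Real.pi * I * (((k i : ℕ) ^ 2 / (4 * a i) : ℚ) : ℂ)) := by
    rw [discrQuad_mk, ratChar_coe, ← Complex.exp_sum, ← Finset.mul_sum, ← Rat.cast_sum]
    congr 3
    rw [h.apply_self, Finset.sum_div]
    refine Finset.sum_congr rfl fun i _ => ?_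
    rw [hx]
    have := ha i
    field_simp
    ring
  simp only [hterm]
  rw [← Fintype.prod_sum fun i (k : Fin (2 * (a i).natAbs)) =>
      cexp (2 * Real.pi * I * (((k : ℕ) ^ 2 / (4 * a i) : ℚ) : ℂ)),
    Finset.prod_congr rfl fun i _ => sum_exp_pi_mul_sq_div_int (a i) (h.ne_zero i),
    Finset.prod_mul_distrib, ← Complex.exp_sum, ← Finset.mul_sum, ← Rat.cast_sum, ← Finset.sum_div,
    h.signature_eq, Complex.ofReal_prod]
  push_cast
  rfl

end IsEvenDiagonal

/-! ### The Gauss sum of a general even lattice. -/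

theorem gaussSum_discrQuad {B : LinearMap.BilinForm ℚ V} (hB : B.IsSymm) (hB' : B.Nondegenerate)
    {L : Submodule ℤ V} (hL : L.IsLattice ℚ) (hE : IsEven B L) :
    ∃ r : ℝ, 0 < r ∧ gaussSum (fun t => ratToReal (discrQuad B hB L hE t)) =
      r * ((ratToReal ((signature B / 8 : ℚ) : AddCircle (1 : ℚ))).toCircle : ℂ) := by
  obtain ⟨n, v, a, h, hle⟩ := exists_isEvenDiagonal hB hB' hL hE
  have hL' : (Submodule.span ℤ (Set.range v)).IsLattice ℚ :=
    ⟨Submodule.fg_span (Set.finite_range v), by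
      rw [Submodule.span_span_of_tower, v.span_eq]⟩
  have := finite_discr hB' hL
  have := finite_discr hB' hL'
  have := Fintype.ofFinite (Discr B L)
  have := Fintype.ofFinite (Discr B (Submodule.span ℤ (Set.range v)))
  obtain ⟨c, hc⟩ := sum_discrQuad_sublattice hB hle hE
  rw [h.sum_discrQuad hB] at hc
  have hpos : 0 < ∏ i, √(2 * (a i).natAbs : ℕ) := by
    refine Finset.prod_pos fun i _ => Real.sqrt_pos.mpr (Nat.cast_pos.mpr ?_)
    have := Int.natAbs_pos.mpr (h.ne_zero i)
    omega
  -- The explicit diagonal sum is non-zero, which forces `c ≠ 0`; dividing by this positive integer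
  -- preserves the phase.
  have hc0 : (c : ℂ) ≠ 0 := by
    intro h0
    rw [h0, zero_mul] at hc
    exact mul_ne_zero (by exact_mod_cast hpos.ne') (Complex.exp_ne_zero _) hc
  have hcpos : (0 : ℝ) < c := Nat.cast_pos.mpr (Nat.pos_of_ne_zero (by exact_mod_cast hc0))
  refine ⟨(∏ i, √(2 * (a i).natAbs : ℕ)) / c, div_pos hpos hcpos, ?_⟩
  rw [gaussSum, finsum_eq_sum_of_fintype, ← ratChar_apply, ratChar_coe]
  refine mul_left_cancel₀ hc0 (hc.symm.trans ?_)
  push_cast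
  field_simp

end Milgram

theorem theorem2p1 {V : Type*} [AddCommGroup V] [Module ℚ V]
    (B : LinearMap.BilinForm ℚ V) (hB : B.IsSymm) :
    -- integral lattices are contained in their duals
    (∀ L : Submodule ℤ V, L.IsLattice ℚ → Milgram.IsIntegral B L → L ≤ Milgram.dual B L) ∧
    -- a lattice on which `Q` is integral is integral
    (∀ L : Submodule ℤ V, L.IsLattice ℚ → Milgram.IsEven B L → Milgram.IsIntegral B L) ∧
    -- for non-singular `B` the discriminant group is finite
    (B.Nondegenerate → ∀ L : Submodule ℤ V, L.IsLattice ℚ → Milgram.IsIntegral B L →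
      Finite (Milgram.Discr B L)) ∧
    -- the induced non-singular quadratic function and the Gauss sum formula
    (B.Nondegenerate → ∀ L : Submodule ℤ V, L.IsLattice ℚ → Milgram.IsEven B L →
      ∃ (ψ : QuadraticMap ℤ (Milgram.Discr B L) (AddCircle (1 : ℚ)))
        (b : LinearMap.BilinMap ℤ (Milgram.Discr B L) (AddCircle (1 : ℚ))),
        -- `Q` induces `ψ`, and `B` induces `b`
        (∀ x : Milgram.dual B L, ψ (Milgram.Discr.mk B L x) = ((B x x / 2 : ℚ) : AddCircle (1 : ℚ))) ∧
        (∀ x y : Milgram.dual B L,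
          b (Milgram.Discr.mk B L x) (Milgram.Discr.mk B L y) = ((B x y : ℚ) : AddCircle (1 : ℚ))) ∧
        -- `b` is symmetric, `ψ` enhances `b`, and `ψ` is non-singular
        (∀ s t, b s t = b t s) ∧
        (∀ s t, b s t = ψ (s + t) - ψ s - ψ t) ∧
        Milgram.IsNonsingular ψ ∧
        -- the Gauss sum is non-zero, and its phase is `σ(B) / 8`
        Milgram.gaussSum (fun t => Milgram.ratToReal (ψ t)) ≠ 0 ∧
        Milgram.phase (fun t => Milgram.ratToReal (ψ t)) =
          Milgram.ratToReal (((Milgram.signature B : ℚ) / 8 : ℚ) : AddCircle (1 : ℚ))) := by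
  refine ⟨fun L _ h => h.le_dual, fun L _ h => h.isIntegral hB,
    fun hB' L hL _ => Milgram.finite_discr hB' hL, fun hB' L hL hE => ?_⟩
  obtain ⟨r, hr, hG⟩ := Milgram.gaussSum_discrQuad hB hB' hL hE
  have hne : Milgram.gaussSum (fun t => Milgram.ratToReal (Milgram.discrQuad B hB L hE t)) ≠ 0 := by
    rw [hG]
    exact mul_ne_zero (Complex.ofReal_ne_zero.mpr hr.ne') (Circle.coe_ne_zero _)
  have hadd (s t) : Milgram.discrBilin B hB L s t = Milgram.discrQuad B hB L hE (s + t) -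
      Milgram.discrQuad B hB L hE s - Milgram.discrQuad B hB L hE t := by
    rw [Milgram.discrQuad_add]
    abel
  refine ⟨Milgram.discrQuad B hB L hE, Milgram.discrBilin B hB L,
    Milgram.discrQuad_mk B hB L hE, Milgram.discrBilin_mk B hB L, fun s t => ?_, hadd,
    Milgram.isNonsingular_discrQuad hB hB' hL hE, hne, ?_⟩
  · rw [hadd, hadd, add_comm s t]
    abel
  · refine ((Milgram.gaussSum_eq_iff _ hne _).mp ?_).symm
    have hnorm : ‖Milgram.gaussSum
        (fun t => Milgram.ratToReal (Milgram.discrQuad B hB L hE t))‖ = r := by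
      rw [hG, norm_mul, Circle.norm_coe, mul_one, Complex.norm_real, Real.norm_of_nonneg hr.le]
    rw [hnorm]
    exact hG
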